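/- Conventions. An indexed forest is a sequence $F=(T_1,T_2,\ldots)$ of binary plane trees (every node has either no child, a leaf, or exactly two children, an internal node), all but finitely many equal to the one-node tree; $\emptyset$ is the forest all of whose trees are one-node trees. The leaves of $F$ are numbered $1,2,3,\ldots$ from left to right, and $\operatorname{supp}(F)$ is the set of leaves of the trees of $F$ that have an internal node. For an internal node $v$ with children $v_L,v_R$, the canonical label of $v$ is the number of the rightmost leaf descendant of $v_L$, and $\rho_F(v)$ is the number of the leftmost leaf descendant of $v$; $v$ is terminal if $v_L,v_R$ are leaves. Put $\operatorname{Qdes}(F)=\{\rho_F(v) : v \text{ terminal}\}$ and, for $i\in\operatorname{Qdes}(F)$, let $F/i$ be the forest obtained by replacing the terminal node $v$ with $\rho_F(v)=i$ by a leaf. A Sylvester word of $F$ is a word listing the canonical label of each internal node of $F$ exactly once, such that the label of each internal node appears before the labels of those of its children that are internal. For $f(\mathbf x;\mathbf t)\in\mathbb Z[\mathbf t][\mathbf x]$, with $\mathbf x=(x_1,x_2,\ldots)$ and $\mathbf t=(t_1,t_2,\ldots)$, and $i\ge 1$ let $$E_if=\frac{f(x_1,\ldots,x_{i-1},x_i,t_i,x_{i+1},\ldots;\mathbf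 t)-f(x_1,\ldots,x_{i-1},t_i,x_i,x_{i+1},\ldots;\mathbf t)}{x_i-t_i}\in\mathbb Z[\mathbf t][\mathbf x],$$ and let $\widehat{\mathbf t}_i=(t_1,\ldots,t_{i-1},t_{i+1},\ldots)$. Theorem. (1) There is a unique family of polynomials $\mathfrak P_F(\mathbf x;\mathbf t)\in\mathbb Z[\mathbf t][\mathbf x]$, indexed by all indexed forests $F$, each homogeneous (for the total degree in $\mathbf x$ and $\mathbf t$ together), such that for all $F$ and all $i\ge 1$ $$\mathfrak P_F(\mathbf t;\mathbf t)=\begin{cases}1&F=\emptyset\\0&\text{otherwise}\end{cases}\qquad\text{and}\qquad E_i\mathfrak P_F=\begin{cases}\mathfrak P_{F/i}(\mathbf x;\widehat{\mathbf t}_i)& i\in\operatorname{Qdes}(F)\\0&\text{otherwise.}\end{cases}$$ (2) Let $n\ge 0$. For $1\le k\le n$ let $\omega^{(k)}_{[n]}=(n,n-1,\ldots,k+1,k,\overline{k+1},\ldots,\overline{n-1},\overline n)$, let $\widetilde\omega_{[n]}=\omega^{(1)}_{[n]}\omega^{(2)}_{[n]}\cdots\omega^{(n)}_{[n]}$ be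 the concatenation, and give the unbarred letter $j$ of $\omega^{(k)}_{[n]}$ the weight $x_k-t_j$ and the barred letter $\overline j$ of $\omega^{(k)}_{[n]}$ the weight $t_j-t_k$. If $\operatorname{supp}(F)\subseteq\{1,\ldots,n+1\}$, then $$\mathfrak P_F(\mathbf x;\mathbf t)=\sum_{\pi}\operatorname{wt}(\pi),$$ where $\pi$ runs over the subwords of $\widetilde\omega_{[n]}$ (sets of positions) whose letters, read from left to right with bars ignored, form a Sylvester word of $F$, and $\operatorname{wt}(\pi)$ is the product of the weights of the letters of $\pi$. -/

import Mathlib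

/-! All index sets are shifted by one: the positive integers `1, 2, 3, …` labelling variables,
trees, leaves, letters, syllables and operators are represented by `0, 1, 2, … : ℕ`. -/

namespace DoubleForest

open MvPolynomial

/-! ### Indexed forests -/

/-- A binary plane tree: `nil` is a leaf, `node () l r` an internal node with two children. -/
abbrev PlaneTree : Type := BinaryTree Unit

/-- An indexed forest: a sequence of binary plane trees, all but finitely many of them trivial. -/
@[ext]
structure IndexedForest where
  tree : ℕ → PlaneTree
  finite_nontrivial : {k | tree k ≠ BinaryTree.nil}.Finite

/-- An internal node, recorded by its leftmost leaf descendant (the flag `ρ`, reached by going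
down left edges) and the subtrees hanging from its left and right children. -/
@[ext]
structure Vertex where
  flag : ℕ
  left : PlaneTree
  right : PlaneTree

/-- The canonical label: the rightmost leaf of the left subtree. That subtree has
`left.numNodes + 1` leaves, the first of which is `flag`. -/
def Vertex.label (v : Vertex) : ℕ := v.flag + v.left.numNodes

/-- Both children are leaves. -/
def Vertex.IsTerminal (v : Vertex) : Prop :=
  v.left = BinaryTree.nil ∧ v.right = BinaryTree.nil

/-- The subtree rooted at `v`. -/
def Vertex.subtree (v : Vertex) : PlaneTree := BinaryTree.node () v.left v.right

/-- `u` is the left or the right child of `v`. -/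
def Vertex.IsChildOf (u v : Vertex) : Prop :=
  (u.flag = v.flag ∧ u.subtree = v.left) ∨
    (u.flag = v.flag + v.left.numLeaves ∧ u.subtree = v.right)

/-- The internal nodes of a tree whose leaves are numbered `s, s + 1, …` from left to right. -/
def internalNodes : ℕ → PlaneTree → List Vertex
  | _, BinaryTree.nil => []
  | s, BinaryTree.node _ l r =>
      ⟨s, l, r⟩ :: (internalNodes s l ++ internalNodes (s + l.numLeaves) r)

/-- Replace the terminal node with flag `i`, if there is one, by a leaf, in a tree whose leaves
are numbered `s, s + 1, …` from left to right. -/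
def trimTree (i : ℕ) : ℕ → PlaneTree → PlaneTree
  | _, BinaryTree.nil => BinaryTree.nil
  | s, BinaryTree.node _ l r =>
      if l = BinaryTree.nil ∧ r = BinaryTree.nil ∧ s = i then BinaryTree.nil
      else BinaryTree.node () (trimTree i s l) (trimTree i (s + l.numLeaves) r)

namespace IndexedForest

/-- The empty forest, all of whose trees are trivial. -/
def empty : IndexedForest where
  tree := fun _ => BinaryTree.nil
  finite_nontrivial := by simp

/-- The number of the first leaf of the `k`-th tree. -/
def start (F : IndexedForest) (k : ℕ) : ℕ := ∑ j ∈ Finset.range k, (F.tree j).numLeaves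

/-- The set of internal nodes of `F`. -/
def internal (F : IndexedForest) : Set Vertex :=
  {v | ∃ k, v ∈ internalNodes (F.start k) (F.tree k)}

/-- The set of leaves of nontrivial trees of `F`. -/
def support (F : IndexedForest) : Set ℕ :=
  {m | ∃ k, F.tree k ≠ BinaryTree.nil ∧ F.start k ≤ m ∧ m < F.start k + (F.tree k).numLeaves}

/-- The set of flags of the terminal nodes. -/
def qdes (F : IndexedForest) : Set ℕ :=
  {i | ∃ v ∈ F.internal, v.IsTerminal ∧ v.flag = i}

/-- The trimmed forest `F / i`, used only for `i ∈ F.qdes`: delete the terminal node with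
flag `i`. -/
def trim (F : IndexedForest) (i : ℕ) : IndexedForest where
  tree := fun k => trimTree i (F.start k) (F.tree k)
  finite_nontrivial := by
    refine F.finite_nontrivial.subset fun k hk h => hk ?_
    simp [h, trimTree]

/-- The Sylvester words of `F`: the canonical labels of the internal nodes of `F`, each written
exactly once, the label of a node coming before the labels of its children. -/
def sylvester (F : IndexedForest) : Set (List ℕ) :=
  {w | w.Nodup ∧ (∀ a, a ∈ w ↔ ∃ v ∈ F.internal, v.label = a) ∧
    ∀ u ∈ F.internal, ∀ v ∈ F.internal, u.IsChildOf v → w.idxOf v.label < w.idxOf u.label}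

end IndexedForest

/-! ### Polynomials and operators -/

/-- The ring `ℤ[t][x]`, as polynomials over `ℤ` in the variables `x` and `t` together, so that
homogeneity refers to the total degree in both sets of variables. -/
abbrev Pol : Type := MvPolynomial (ℕ ⊕ ℕ) ℤ

noncomputable def x (i : ℕ) : Pol := X (Sum.inl i)

noncomputable def t (i : ℕ) : Pol := X (Sum.inr i)

/-- The substitution `f(a; b)`. -/
noncomputable def subst (a b : ℕ → Pol) : Pol →ₐ[ℤ] Pol := aeval (Sum.elim a b)

/-- `f(x_1, …, x_{i-1}, t_i, x_i, x_{i+1}, …; t)`. -/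
noncomputable def ropeMinus (i : ℕ) : Pol →ₐ[ℤ] Pol :=
  subst (fun j => if j < i then x j else if j = i then t i else x (j - 1)) t

/-- `f(x_1, …, x_{i-1}, x_i, t_i, x_{i+1}, …; t)`. -/
noncomputable def ropePlus (i : ℕ) : Pol →ₐ[ℤ] Pol :=
  subst (fun j => if j ≤ i then x j else if j = i + 1 then t i else x (j - 1)) t

theorem dvd_ropePlus_sub_ropeMinus (i : ℕ) (f : Pol) :
    x i - t i ∣ ropePlus i f - ropeMinus i f := by
  rw [← Ideal.mem_span_singleton, ← Ideal.Quotient.mk_eq_mk_iff_sub_mem]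
  have hxt : Ideal.Quotient.mk (Ideal.span {x i - t i}) (x i) =
      Ideal.Quotient.mk (Ideal.span {x i - t i}) (t i) := by
    rw [Ideal.Quotient.mk_eq_mk_iff_sub_mem]
    exact Ideal.mem_span_singleton_self _
  have h : (Ideal.Quotient.mkₐ ℤ (Ideal.span {x i - t i})).comp (ropePlus i) =
      (Ideal.Quotient.mkₐ ℤ (Ideal.span {x i - t i})).comp (ropeMinus i) := by
    apply MvPolynomial.algHom_ext
    rintro (j | j)
    · simp only [ropePlus, ropeMinus, subst, AlgHom.comp_apply, aeval_X, Sum.elim_inl,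
        Ideal.Quotient.mkₐ_eq_mk]
      rcases lt_trichotomy j i with h | h | h
      · rw [if_pos h.le, if_pos h]
      · subst h
        simpa using hxt
      · have h1 : ¬ j ≤ i := by omega
        have h2 : ¬ j < i := by omega
        have h3 : ¬ j = i := by omega
        rw [if_neg h1, if_neg h2, if_neg h3]
        by_cases h' : j = i + 1
        · subst h'
          simp [hxt]
        · rw [if_neg h']
    · simp [ropePlus, ropeMinus, subst]
  exact DFunLike.congr_fun h f

/-- The equivariant trimming operation: the exact quotient of `ropePlus i f - ropeMinus i f`
by `x_i - t_i`. -/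
noncomputable def eope (i : ℕ) (f : Pol) : Pol :=
  Classical.choose (dvd_ropePlus_sub_ropeMinus i f)

theorem mul_eope (i : ℕ) (f : Pol) :
    (x i - t i) * eope i f = ropePlus i f - ropeMinus i f :=
  (Classical.choose_spec (dvd_ropePlus_sub_ropeMinus i f)).symm

/-- The sequence `t` with its `i`-th entry omitted. -/
noncomputable def tHat (i : ℕ) : ℕ → Pol := fun j => if j < i then t j else t (j + 1)

open Classical in
/-- The defining properties of the family of double forest polynomials. -/
structure IsDoubleForestFamily (P : IndexedForest → Pol) : Prop where
  homogeneous : ∀ F, ∃ d, (P F).IsHomogeneous d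
  normalized : ∀ F, subst t t (P F) = if F = IndexedForest.empty then 1 else 0
  recursion : ∀ F i,
    eope i (P F) = if i ∈ F.qdes then subst x (tHat i) (P (F.trim i)) else 0

/-! ### The vine subword model -/

open Classical in
/-- The subword generating function of a set `D` of words in a word `ω`, whose letters carry a
value and a weight. `ω.sublists` runs over the subsets of positions of `ω`. -/
noncomputable def subwordSum {α : Type} (value : α → ℕ) (weight : α → Pol) (ω : List α)
    (D : Set (List ℕ)) : Pol :=
  ((ω.sublists.filter fun π => π.map value ∈ D).map fun π => (π.map weight).prod).sum

/-- A letter of the long word, unbarred or barred. -/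
structure Letter where
  value : ℕ
  syllable : ℕ
  barred : Bool

/-- The `k`-th syllable `n, n-1, …, k+1, k, \overline{k+1}, …, \overline{n}`. -/
def syllable (n k : ℕ) : List Letter :=
  (List.Ico k n).reverse.map (fun j => ⟨j, k, false⟩) ++
    (List.Ico (k + 1) n).map (fun j => ⟨j, k, true⟩)

/-- The long word: the concatenation of the `n` syllables. -/
def longWord (n : ℕ) : List Letter := (List.range n).flatMap (syllable n)

/-- The unbarred letter `j` in the `i`-th syllable has weight `x_i - t_j`, the barred one
`t_j - t_i`. -/
noncomputable def letterWeight (a : Letter) : Pol :=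
  if a.barred then t a.value - t a.syllable else x a.syllable - t a.value

end DoubleForest

/-! A subword sum over the Sylvester words of `F` only sees words without repeated letters, so two
adjacent equal letters of opposite weights may be erased from the long word. Hence a syllable with
`x_k = t_k` cancels, its descending run against its ascending run. It follows that both ropes at
`i` reduce the long word to the same word, except that `ropePlus i` leaves one more letter `i`, of
weight `x_i - t_i`, which is therefore extracted by `eope i`. All letters after its position are at
least `i + 2`, so in a Sylvester word using it `i - 1` and `i + 1` come before `i`. As the labels
of the descendants of a node form an interval, the node labelled `i` must then be terminal, and
erasing `i` from the word trims that node.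

For uniqueness, if `f` involves no `x_j` with `j > i`, then `ropePlus i f = f`, while
`ropeMinus i f` is `f` with `x_i = t_i`. So if all `eope i f` vanish, then the variables `x_i` can
be specialized to `t_i` one at a time, from the last one down, and `f(x; t) = f(t; t)`. -/

namespace DoubleForest

/-! ### Ancestors in terms of labels -/

/-- The last label in the subtree rooted at `v`, whose labels are `v.flag, …, v.last`. -/
def Vertex.last (v : Vertex) : ℕ := v.label + v.right.numNodes

theorem Vertex.flag_le_label (v : Vertex) : v.flag ≤ v.label :=
  Nat.le_add_right _ _

theorem Vertex.label_le_last (v : Vertex) : v.label ≤ v.last :=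
  Nat.le_add_right _ _

theorem numNodes_eq_zero {T : PlaneTree} : T.numNodes = 0 ↔ T = BinaryTree.nil := by
  cases T <;> simp [BinaryTree.numNodes]

theorem Vertex.isTerminal_iff {v : Vertex} : v.IsTerminal ↔ v.flag = v.last := by
  rw [IsTerminal, ← numNodes_eq_zero, ← numNodes_eq_zero, last, label]
  omega

theorem mem_internalNodes_node {s : ℕ} {x : Unit} {l r : PlaneTree} {v : Vertex} :
    v ∈ internalNodes s (BinaryTree.node x l r) ↔
      v = ⟨s, l, r⟩ ∨ v ∈ internalNodes s l ∨ v ∈ internalNodes (s + l.numNodes + 1) r := by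
  simp [internalNodes, BinaryTree.numLeaves_eq_numNodes_succ, add_assoc]

theorem internalNodes_bounds {s : ℕ} {T : PlaneTree} {v : Vertex} (hv : v ∈ internalNodes s T) :
    s ≤ v.flag ∧ v.last < s + T.numNodes := by
  induction T generalizing s with
  | nil => simp [internalNodes] at hv
  | node _ l r ihl ihr =>
    rw [BinaryTree.numNodes]
    rcases mem_internalNodes_node.1 hv with rfl | hv | hv
    · simp only [Vertex.last, Vertex.label]
      omega
    · have := ihl hv
      omega
    · have := ihr hv
      omega

theorem label_injOn_internalNodes (s : ℕ) (T : PlaneTree) :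
    Set.InjOn Vertex.label {v | v ∈ internalNodes s T} := by
  induction T generalizing s with
  | nil => simp [internalNodes]
  | node _ l r ihl ihr =>
    intro u hu v hv huv
    have bounds {s' : ℕ} {T' : PlaneTree} {w : Vertex} (hw : w ∈ internalNodes s' T') :
        s' ≤ w.label ∧ w.label < s' + T'.numNodes :=
      ⟨(internalNodes_bounds hw).1.trans w.flag_le_label,
        w.label_le_last.trans_lt (internalNodes_bounds hw).2⟩
    rcases mem_internalNodes_node.1 hu with rfl | hu | hu <;>
      rcases mem_internalNodes_node.1 hv with rfl | hv | hv <;>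
      grind [Vertex.label, Set.InjOn]

/-- Some node of `T`, whose leaves are numbered `s, s + 1, …`, has the label `a` and is the node
labelled `b` or an ancestor of it. -/
def TreeAncestor (s : ℕ) (T : PlaneTree) (a b : ℕ) : Prop :=
  ∃ v ∈ internalNodes s T, v.label = a ∧ v.flag ≤ b ∧ b ≤ v.last

theorem not_treeAncestor_nil {s a b : ℕ} : ¬ TreeAncestor s BinaryTree.nil a b := by
  simp [TreeAncestor, internalNodes]

theorem treeAncestor_node {s a b : ℕ} {x : Unit} {l r : PlaneTree} :
    TreeAncestor s (BinaryTree.node x l r) a b ↔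
      (a = s + l.numNodes ∧ s ≤ b ∧ b ≤ s + l.numNodes + r.numNodes) ∨
        TreeAncestor s l a b ∨ TreeAncestor (s + l.numNodes + 1) r a b := by
  simp only [TreeAncestor, mem_internalNodes_node, or_and_right, exists_or, exists_eq_left]
  rw [eq_comm]
  rfl

theorem TreeAncestor.bounds {s a b : ℕ} {T : PlaneTree} (h : TreeAncestor s T a b) :
    (s ≤ a ∧ a < s + T.numNodes) ∧ s ≤ b ∧ b < s + T.numNodes := by
  obtain ⟨v, hv, rfl, hb⟩ := h
  have := internalNodes_bounds hv
  have := v.flag_le_label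
  have := v.label_le_last
  omega

theorem treeAncestor_self_iff {s a : ℕ} {T : PlaneTree} :
    TreeAncestor s T a a ↔ s ≤ a ∧ a < s + T.numNodes := by
  refine ⟨fun h => h.bounds.1, fun h => ?_⟩
  induction T generalizing s with
  | nil => simp [BinaryTree.numNodes] at h; omega
  | node _ l r ihl ihr =>
    rw [BinaryTree.numNodes] at h
    rw [treeAncestor_node]
    rcases lt_trichotomy a (s + l.numNodes) with ha | ha | ha
    · exact .inr (.inl (ihl ⟨h.1, ha⟩))
    · exact .inl (by omega)
    · exact .inr (.inr (ihr (by omega)))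

theorem TreeAncestor.apply_le_apply {α : Type*} [Preorder α] {f : ℕ → α} {s a b : ℕ}
    {T : PlaneTree}
    (hf : ∀ u ∈ internalNodes s T, ∀ v ∈ internalNodes s T, u.IsChildOf v →
      f v.label ≤ f u.label)
    (h : TreeAncestor s T a b) : f a ≤ f b := by
  induction T generalizing s a with
  | nil => exact absurd h not_treeAncestor_nil
  | node _ l r ihl ihr =>
    have left_le {a' : ℕ} : TreeAncestor s l a' b → f a' ≤ f b :=
      ihl fun u hu v hv => hf u (by simp [mem_internalNodes_node, hu]) v
        (by simp [mem_internalNodes_node, hv])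
    have right_le {a' : ℕ} : TreeAncestor (s + l.numNodes + 1) r a' b → f a' ≤ f b :=
      ihr fun u hu v hv => hf u (by simp [mem_internalNodes_node, hu]) v
        (by simp [mem_internalNodes_node, hv])
    have root_le (u : Vertex) (hu : u ∈ internalNodes s (BinaryTree.node () l r)) :
        u.IsChildOf ⟨s, l, r⟩ → f (s + l.numNodes) ≤ f u.label :=
      hf u hu ⟨s, l, r⟩ (by simp [mem_internalNodes_node])
    rcases treeAncestor_node.1 h with ⟨rfl, hsb, hbl⟩ | h | h
    · rcases lt_trichotomy b (s + l.numNodes) with hb | rfl | hb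
      · cases l with
        | nil => simp [BinaryTree.numNodes] at hb; omega
        | node _ l₁ l₂ =>
          refine (root_le ⟨s, l₁, l₂⟩ (by simp [mem_internalNodes_node]) (.inl ⟨rfl, rfl⟩)).trans
            (left_le (treeAncestor_node.2 (.inl ⟨rfl, ?_⟩)))
          rw [BinaryTree.numNodes] at hb
          omega
      · exact le_rfl
      · cases r with
        | nil => simp [BinaryTree.numNodes] at hbl; omega
        | node _ r₁ r₂ =>
          refine (root_le ⟨s + l.numNodes + 1, r₁, r₂⟩ (by simp [mem_internalNodes_node])
            (.inr ⟨by rw [BinaryTree.numLeaves_eq_numNodes_succ, add_assoc], rfl⟩)).trans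
            (right_le (treeAncestor_node.2 (.inl ⟨rfl, ?_⟩)))
          rw [BinaryTree.numNodes] at hbl
          omega
    · exact left_le h
    · exact right_le h

/-! ### Trimming a tree -/

/-- The increasing map `ℕ → ℕ` whose image omits `i`, as `Fin.succAbove`. -/
def succAbove (i a : ℕ) : ℕ := if a < i then a else a + 1

theorem succAbove_strictMono (i : ℕ) : StrictMono (succAbove i) := by
  intro a b h
  grind [succAbove]

theorem range_succAbove (i : ℕ) : Set.range (succAbove i) = {i}ᶜ := by
  ext b
  simp only [Set.mem_range, Set.mem_compl_singleton_iff, succAbove]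
  refine ⟨?_, fun h => ⟨if b < i then b else b - 1, ?_⟩⟩ <;> grind

theorem succAbove_ne (i a : ℕ) : succAbove i a ≠ i := by
  have := Set.mem_range_self (f := succAbove i) a
  rwa [range_succAbove] at this

theorem treeAncestor_succAbove_of_le {s i a b : ℕ} {T : PlaneTree} (h : s + T.numNodes ≤ i) :
    TreeAncestor s T (succAbove i a) (succAbove i b) ↔ TreeAncestor s T a b := by
  have hfix {c : ℕ} (hc : c < i) : succAbove i c = c := if_pos hc
  have hlt {c : ℕ} (hc : succAbove i c < i) : c < i := by grind [succAbove]
  constructor <;> intro hab <;> have := hab.bounds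
  · rwa [hfix (hlt (by omega)), hfix (hlt (by omega))] at hab
  · rwa [hfix (by omega), hfix (by omega)]

theorem treeAncestor_succ {s a b : ℕ} {T : PlaneTree} :
    TreeAncestor (s + 1) T (a + 1) (b + 1) ↔ TreeAncestor s T a b := by
  induction T generalizing s with
  | nil => simp [not_treeAncestor_nil]
  | node _ l r ihl ihr =>
    rw [treeAncestor_node, treeAncestor_node, ihl, ← ihr]
    refine or_congr (by omega) (or_congr Iff.rfl ?_)
    rw [show s + 1 + l.numNodes = s + l.numNodes + 1 by omega]

theorem treeAncestor_succ_succAbove_of_ge {s i a b : ℕ} {T : PlaneTree} (h : i ≤ s) :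
    TreeAncestor (s + 1) T (succAbove i a) (succAbove i b) ↔ TreeAncestor s T a b := by
  rw [← treeAncestor_succ (s := s)]
  have hge {c : ℕ} (hc : i ≤ c) : succAbove i c = c + 1 := if_neg (by omega)
  have hle {c : ℕ} (hc : i < succAbove i c) : i ≤ c := by grind [succAbove]
  constructor <;> intro hab <;> have := hab.bounds
  · rwa [hge (hle (by omega)), hge (hle (by omega))] at hab
  · rwa [hge (by omega), hge (by omega)]

theorem trimTree_eq_self {i s : ℕ} {T : PlaneTree} (h : i < s ∨ s + T.numNodes ≤ i) :
    trimTree i s T = T := by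
  induction T generalizing s with
  | nil => rfl
  | node _ l r ihl ihr =>
    rw [BinaryTree.numNodes] at h
    rw [trimTree, if_neg (by omega), ihl (by omega), ihr]
    rw [BinaryTree.numLeaves_eq_numNodes_succ]
    omega

theorem trimTree_node_of_left {i s : ℕ} {x : Unit} {l r : PlaneTree}
    (h : ⟨i, BinaryTree.nil, BinaryTree.nil⟩ ∈ internalNodes s l) :
    trimTree i s (BinaryTree.node x l r) = BinaryTree.node () (trimTree i s l) r := by
  have hi : i < s + l.numNodes := (internalNodes_bounds h).2
  rw [trimTree, if_neg, trimTree_eq_self (T := r)]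
  · rw [BinaryTree.numLeaves_eq_numNodes_succ]
    omega
  · rintro ⟨rfl, -⟩
    simp [internalNodes] at h

theorem trimTree_node_of_right {i s : ℕ} {x : Unit} {l r : PlaneTree}
    (h : ⟨i, BinaryTree.nil, BinaryTree.nil⟩ ∈ internalNodes (s + l.numNodes + 1) r) :
    trimTree i s (BinaryTree.node x l r) =
      BinaryTree.node () l (trimTree i (s + l.numNodes + 1) r) := by
  have hi : s + l.numNodes + 1 ≤ i := (internalNodes_bounds h).1
  rw [trimTree, if_neg (by omega), trimTree_eq_self (T := l) (by omega),
    BinaryTree.numLeaves_eq_numNodes_succ, add_assoc s]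

theorem numNodes_trimTree {i s : ℕ} {T : PlaneTree}
    (h : ⟨i, BinaryTree.nil, BinaryTree.nil⟩ ∈ internalNodes s T) :
    (trimTree i s T).numNodes + 1 = T.numNodes := by
  induction T generalizing s with
  | nil => simp [internalNodes] at h
  | node _ l r ihl ihr =>
    rcases mem_internalNodes_node.1 h with hv | h | h
    · obtain ⟨rfl, rfl, rfl⟩ := Vertex.mk.inj hv
      rw [trimTree, if_pos ⟨rfl, rfl, rfl⟩]
      rfl
    · rw [trimTree_node_of_left h, BinaryTree.numNodes, BinaryTree.numNodes, ← ihl h]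
      omega
    · rw [trimTree_node_of_right h, BinaryTree.numNodes, BinaryTree.numNodes, ← ihr h]
      omega

theorem treeAncestor_trimTree {i s a b : ℕ} {T : PlaneTree}
    (h : ⟨i, BinaryTree.nil, BinaryTree.nil⟩ ∈ internalNodes s T) :
    TreeAncestor s (trimTree i s T) a b ↔ TreeAncestor s T (succAbove i a) (succAbove i b) := by
  induction T generalizing s with
  | nil => simp [internalNodes] at h
  | node _ l r ihl ihr =>
    rcases mem_internalNodes_node.1 h with hv | h | h
    · obtain ⟨rfl, rfl, rfl⟩ := Vertex.mk.inj hv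
      rw [trimTree, if_pos ⟨rfl, rfl, rfl⟩, treeAncestor_node]
      have := succAbove_ne i a
      simpa [not_treeAncestor_nil, BinaryTree.numNodes] using fun h => absurd h this
    · have hi : s ≤ i ∧ i < s + l.numNodes := internalNodes_bounds h
      have hl := numNodes_trimTree h
      rw [trimTree_node_of_left h, treeAncestor_node, treeAncestor_node, ihl h, ← hl,
        ← add_assoc s, treeAncestor_succ_succAbove_of_ge (by omega)]
      refine or_congr ?_ Iff.rfl
      grind [succAbove]
    · have hi : s + l.numNodes + 1 ≤ i ∧ i < s + l.numNodes + 1 + r.numNodes :=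
        internalNodes_bounds h
      have hr := numNodes_trimTree h
      rw [trimTree_node_of_right h, treeAncestor_node, treeAncestor_node, ihr h,
        treeAncestor_succAbove_of_le (T := l) (by omega)]
      refine or_congr ?_ Iff.rfl
      grind [succAbove]

namespace IndexedForest

/-! ### Ancestors and trimming in a forest -/

/-- The set of canonical labels of the internal nodes. -/
def labels (F : IndexedForest) : Set ℕ := Vertex.label '' F.internal

/-- Some node of `F` has the label `a` and is the node labelled `b` or an ancestor of it. -/
def Ancestor (F : IndexedForest) (a b : ℕ) : Prop :=
  ∃ k, TreeAncestor (F.start k) (F.tree k) a b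

variable {F : IndexedForest} {i m k a b c n : ℕ}

theorem ancestor_iff :
    F.Ancestor a b ↔ ∃ v ∈ F.internal, v.label = a ∧ v.flag ≤ b ∧ b ≤ v.last :=
  ⟨fun ⟨k, v, hv, h⟩ => ⟨v, ⟨k, hv⟩, h⟩, fun ⟨v, ⟨k, hv⟩, h⟩ => ⟨k, v, hv, h⟩⟩

theorem mem_labels_iff : a ∈ F.labels ↔ F.Ancestor a a := by
  rw [ancestor_iff]
  constructor
  · rintro ⟨v, hv, rfl⟩
    exact ⟨v, hv, rfl, v.flag_le_label, v.label_le_last⟩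
  · rintro ⟨v, hv, rfl, -⟩
    exact ⟨v, hv, rfl⟩

theorem mem_labels_iff_exists :
    a ∈ F.labels ↔ ∃ k, F.start k ≤ a ∧ a < F.start k + (F.tree k).numNodes := by
  rw [mem_labels_iff]
  exact exists_congr fun k => treeAncestor_self_iff

theorem Ancestor.of_mem_uIcc (h : F.Ancestor a b) (hc : c ∈ Set.uIcc a b) : F.Ancestor a c := by
  obtain ⟨k, v, hv, rfl, hb⟩ := h
  have := v.flag_le_label
  have := v.label_le_last
  rw [Set.mem_uIcc] at hc
  exact ⟨k, v, hv, rfl, by omega, by omega⟩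

theorem Ancestor.right_mem (h : F.Ancestor a b) : b ∈ F.labels := by
  rw [mem_labels_iff_exists]
  exact h.imp fun k hk => hk.bounds.2

theorem start_succ : F.start (k + 1) = F.start k + (F.tree k).numNodes + 1 := by
  rw [start, Finset.sum_range_succ, BinaryTree.numLeaves_eq_numNodes_succ, ← add_assoc, ← start]

theorem start_add_lt (h : m < k) : F.start m + (F.tree m).numNodes < F.start k := by
  induction k, h using Nat.le_induction with
  | base => simp [start_succ]
  | succ k _ ih => rw [start_succ]; omega

theorem label_injOn_internal : Set.InjOn Vertex.label F.internal := by
  rintro u ⟨k, hu⟩ v ⟨m, hv⟩ huv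
  have hbu := internalNodes_bounds hu
  have hbv := internalNodes_bounds hv
  have := u.flag_le_label
  have := u.label_le_last
  have := v.flag_le_label
  have := v.label_le_last
  obtain rfl : k = m := by
    rcases lt_trichotomy k m with h | h | h
    · have := F.start_add_lt h
      omega
    · exact h
    · have := F.start_add_lt h
      omega
  exact label_injOn_internalNodes _ _ hu hv huv

theorem mem_qdes_iff_exists :
    i ∈ F.qdes ↔
      ∃ k, ⟨i, BinaryTree.nil, BinaryTree.nil⟩ ∈ internalNodes (F.start k) (F.tree k) := by
  constructor
  · rintro ⟨⟨_, _, _⟩, ⟨k, hv⟩, ⟨rfl, rfl⟩, rfl⟩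
    exact ⟨k, hv⟩
  · rintro ⟨k, hv⟩
    exact ⟨_, ⟨k, hv⟩, ⟨rfl, rfl⟩, rfl⟩

theorem mem_qdes_iff : i ∈ F.qdes ↔ ∀ b, F.Ancestor i b ↔ b = i := by
  constructor
  · rintro ⟨v, hv, hterm, rfl⟩ b
    have hlabel : v.label = v.flag :=
      (v.label_le_last.trans_eq (v.isTerminal_iff.1 hterm).symm).antisymm v.flag_le_label
    rw [ancestor_iff, Vertex.isTerminal_iff] at *
    constructor
    · rintro ⟨u, hu, huv, hb⟩
      obtain rfl := label_injOn_internal hu hv (huv.trans hlabel.symm)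
      omega
    · rintro rfl
      exact ⟨v, hv, hlabel, le_rfl, hterm.le⟩
  · intro h
    obtain ⟨v, hv, hvi, -⟩ := ancestor_iff.1 ((h i).2 rfl)
    have := v.flag_le_label
    have := v.label_le_last
    have hflag : v.flag = i := (h _).1 (ancestor_iff.2 ⟨v, hv, hvi, le_rfl, by omega⟩)
    have hlast : v.last = i := (h _).1 (ancestor_iff.2 ⟨v, hv, hvi, by omega, le_rfl⟩)
    exact ⟨v, hv, v.isTerminal_iff.2 (hflag.trans hlast.symm), hflag⟩

section Trim

variable (h : ⟨i, BinaryTree.nil, BinaryTree.nil⟩ ∈ internalNodes (F.start m) (F.tree m))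
include h

theorem trim_tree_of_ne (hk : k ≠ m) : (F.trim i).tree k = F.tree k := by
  have : F.start m ≤ i ∧ i < F.start m + (F.tree m).numNodes := internalNodes_bounds h
  refine trimTree_eq_self ?_
  rcases lt_or_gt_of_ne hk with hk | hk <;> have := F.start_add_lt hk <;> omega

theorem trim_start_of_le (hk : k ≤ m) : (F.trim i).start k = F.start k :=
  Finset.sum_congr rfl fun j hj => by
    rw [trim_tree_of_ne h ((Finset.mem_range.1 hj).trans_le hk).ne]

theorem trim_start_add_one_of_lt (hk : m < k) : (F.trim i).start k + 1 = F.start k := by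
  induction k, hk using Nat.le_induction with
  | base =>
    have : ((F.trim i).tree m).numNodes = (trimTree i (F.start m) (F.tree m)).numNodes := rfl
    rw [start_succ, start_succ, trim_start_of_le h le_rfl, ← numNodes_trimTree h, this]
    omega
  | succ k hk ih =>
    rw [start_succ, start_succ, trim_tree_of_ne h (by omega)]
    omega

end Trim

theorem ancestor_trim_iff (hi : i ∈ F.qdes) :
    (F.trim i).Ancestor a b ↔ F.Ancestor (succAbove i a) (succAbove i b) := by
  obtain ⟨m, h⟩ := mem_qdes_iff_exists.1 hi
  have hm : F.start m ≤ i ∧ i < F.start m + (F.tree m).numNodes := internalNodes_bounds h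
  refine exists_congr fun k => ?_
  rcases lt_trichotomy k m with hk | rfl | hk
  · have := F.start_add_lt hk
    rw [trim_tree_of_ne h hk.ne, trim_start_of_le h hk.le, treeAncestor_succAbove_of_le (by omega)]
  · rw [trim_start_of_le h le_rfl]
    exact treeAncestor_trimTree h
  · have := F.start_add_lt hk
    rw [trim_tree_of_ne h hk.ne', ← trim_start_add_one_of_lt h hk,
      treeAncestor_succ_succAbove_of_ge]
    have := trim_start_add_one_of_lt h hk
    omega

theorem succAbove_mem_labels_iff (hi : i ∈ F.qdes) :
    succAbove i a ∈ F.labels ↔ a ∈ (F.trim i).labels := by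
  rw [mem_labels_iff, mem_labels_iff, ancestor_trim_iff hi]

theorem mem_labels_of_mem_qdes (hi : i ∈ F.qdes) : i ∈ F.labels :=
  mem_labels_iff.2 ((mem_qdes_iff.1 hi i).2 rfl)

theorem labels_eq_empty_iff : F.labels = ∅ ↔ F = empty := by
  simp only [Set.eq_empty_iff_forall_notMem, mem_labels_iff_exists, not_exists]
  constructor
  · intro h
    ext k : 2
    have := h (F.start k) k
    exact numNodes_eq_zero.1 (by omega)
  · rintro rfl a k
    simp [empty, BinaryTree.numNodes]

theorem support_subset_iff : F.support ⊆ Set.Iio (n + 1) ↔ F.labels ⊆ Set.Iio n := by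
  constructor
  · intro h a ha
    obtain ⟨k, h₁, h₂⟩ := mem_labels_iff_exists.1 ha
    have hne : F.tree k ≠ BinaryTree.nil := fun e => by
      rw [e, BinaryTree.numNodes] at h₂
      omega
    have : F.start k + (F.tree k).numNodes < n + 1 :=
      h ⟨k, hne, by omega, by rw [BinaryTree.numLeaves_eq_numNodes_succ]; omega⟩
    exact Set.mem_Iio.2 (by omega)
  · rintro h m ⟨k, hne, -, hm⟩
    rw [ne_eq, ← numNodes_eq_zero] at hne
    rw [BinaryTree.numLeaves_eq_numNodes_succ] at hm
    have : F.start k + (F.tree k).numNodes - 1 < n :=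
      h (mem_labels_iff_exists.2 ⟨k, by omega, by omega⟩)
    exact Set.mem_Iio.2 (by omega)

theorem exists_support_subset (F : IndexedForest) : ∃ n, F.support ⊆ Set.Iio (n + 1) := by
  obtain ⟨n, hn⟩ := (F.finite_nontrivial.image fun k => F.start k + (F.tree k).numNodes).bddAbove
  refine ⟨n, ?_⟩
  rintro m ⟨k, hne, -, hm⟩
  have : F.start k + (F.tree k).numNodes ≤ n := hn ⟨k, hne, rfl⟩
  rw [BinaryTree.numLeaves_eq_numNodes_succ] at hm
  exact Set.mem_Iio.2 (by omega)

theorem lt_of_mem_qdes (h : F.support ⊆ Set.Iio (n + 1)) (hi : i ∈ F.qdes) : i < n :=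
  support_subset_iff.1 h (mem_labels_of_mem_qdes hi)

theorem support_trim_subset (h : F.support ⊆ Set.Iio (n + 1 + 1)) (hi : i ∈ F.qdes) :
    (F.trim i).support ⊆ Set.Iio (n + 1) := by
  have hin := lt_of_mem_qdes h hi
  rw [support_subset_iff] at h ⊢
  intro a ha
  have : succAbove i a < n + 1 := h ((succAbove_mem_labels_iff hi).2 ha)
  exact Set.mem_Iio.2 (by grind [succAbove])

end IndexedForest

/-! ### Sylvester words -/

theorem Vertex.IsChildOf.label_ne_and_bounds {u v : Vertex} (h : u.IsChildOf v) :
    v.label ≠ u.label ∧ v.flag ≤ u.label ∧ u.label ≤ v.last := by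
  have hsub : u.subtree.numNodes = u.left.numNodes + u.right.numNodes + 1 := rfl
  simp only [label, last]
  rcases h with ⟨hflag, hv⟩ | ⟨hflag, hv⟩ <;> rw [hv] at hsub
  · omega
  · rw [BinaryTree.numLeaves_eq_numNodes_succ] at hflag
    omega

namespace IndexedForest

variable {F : IndexedForest} {i a : ℕ} {u v w : List ℕ}

theorem mem_sylvester_iff :
    w ∈ F.sylvester ↔ (∀ a, a ∈ w ↔ a ∈ F.labels) ∧ w.Pairwise fun a b => ¬ F.Ancestor b a := by
  constructor
  · rintro ⟨hnodup, hmem, hlt⟩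
    refine ⟨hmem, List.pairwise_iff_getElem.2 fun j k hj hk hjk ⟨m, hm⟩ => ?_⟩
    have hle : w.idxOf w[k] ≤ w.idxOf w[j] :=
      hm.apply_le_apply (f := (w.idxOf ·)) fun u hu v hv huv => (hlt u ⟨m, hu⟩ v ⟨m, hv⟩ huv).le
    rw [hnodup.idxOf_getElem, hnodup.idxOf_getElem] at hle
    omega
  · rintro ⟨hmem, hpair⟩
    refine ⟨hpair.imp_of_mem fun ha _ hab => ?_, hmem, fun u hu v hv huv => ?_⟩
    · rintro rfl
      exact hab (mem_labels_iff.1 ((hmem _).1 ha))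
    · obtain ⟨hne, hbounds⟩ := huv.label_ne_and_bounds
      have hmemu : u.label ∈ w := (hmem _).2 ⟨u, hu, rfl⟩
      have hmemv : v.label ∈ w := (hmem _).2 ⟨v, hv, rfl⟩
      by_contra! hle
      have hlt := lt_of_le_of_ne hle fun h => hne ((List.idxOf_inj hmemu).1 h).symm
      have := List.pairwise_iff_getElem.1 hpair _ _ (List.idxOf_lt_length_of_mem hmemu)
        (List.idxOf_lt_length_of_mem hmemv) hlt
      rw [List.getElem_idxOf, List.getElem_idxOf] at this
      exact this (ancestor_iff.2 ⟨v, hv, rfl, hbounds⟩)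

theorem nil_mem_sylvester_iff : [] ∈ F.sylvester ↔ F = empty := by
  rw [mem_sylvester_iff, ← labels_eq_empty_iff, Set.eq_empty_iff_forall_notMem]
  simp

theorem perm_of_mem_sylvester (hv : v ∈ F.sylvester) (hw : w ∈ F.sylvester) : v.Perm w :=
  (List.perm_ext_iff_of_nodup hv.1 hw.1).2 fun a => (hv.2.1 a).trans (hw.2.1 a).symm

theorem mem_qdes_of_append_cons_mem_sylvester (h : u ++ i :: v ∈ F.sylvester)
    (hv : ∀ b ∈ v, i + 2 ≤ b) : i ∈ F.qdes := by
  rw [mem_sylvester_iff] at h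
  have not_ancestor {c : ℕ} (hc : c ≠ i) (hci : c < i + 2) : ¬ F.Ancestor i c := by
    intro hic
    have hcu : c ∈ u := by
      have := (h.1 c).2 hic.right_mem
      grind
    exact (List.pairwise_append.1 h.2).2.2 c hcu i List.mem_cons_self hic
  refine mem_qdes_iff.2 fun b => ⟨fun hib => ?_, ?_⟩
  · by_contra hb
    rcases lt_or_gt_of_ne hb with hb | hb
    · exact not_ancestor (c := i - 1) (by omega) (by omega)
        (hib.of_mem_uIcc (Set.mem_uIcc.2 (by omega)))
    · exact not_ancestor (c := i + 1) (by omega) (by omega)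
        (hib.of_mem_uIcc (Set.mem_uIcc.2 (by omega)))
  · rintro rfl
    exact mem_labels_iff.1 ((h.1 b).1 (by simp))

theorem mem_image_sylvester_trim_iff (hi : i ∈ F.qdes) :
    w ∈ List.map (succAbove i) '' (F.trim i).sylvester ↔
      (∀ a, a ∈ w ↔ a ∈ F.labels ∧ a ≠ i) ∧ w.Pairwise fun a b => ¬ F.Ancestor b a := by
  have hinj := (succAbove_strictMono i).injective
  by_cases hw : i ∈ w
  · refine iff_of_false ?_ fun h => ((h.1 i).1 hw).2 rfl
    rintro ⟨w', -, rfl⟩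
    obtain ⟨a, -, ha⟩ := List.mem_map.1 hw
    exact succAbove_ne i a ha
  · obtain ⟨w', rfl⟩ : w ∈ Set.range (List.map (succAbove i)) := by
      rw [Set.range_list_map, range_succAbove]
      exact fun a ha => ne_of_mem_of_not_mem ha hw
    rw [(List.map_injective_iff.2 hinj).mem_set_image, mem_sylvester_iff, List.pairwise_map]
    simp only [ancestor_trim_iff hi]
    refine and_congr_left fun _ => ⟨fun h a => ?_, fun h a => ?_⟩
    · by_cases ha : a = i
      · simp [ha, hw]
      · obtain ⟨a, rfl⟩ : a ∈ Set.range (succAbove i) := by rwa [range_succAbove]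
        rw [List.mem_map_of_injective hinj, h, succAbove_mem_labels_iff hi]
        exact (and_iff_left ha).symm
    · rw [← List.mem_map_of_injective hinj, h, succAbove_mem_labels_iff hi]
      exact and_iff_left (succAbove_ne i a)

theorem append_cons_mem_sylvester_iff (hi : i ∈ F.qdes) (hv : ∀ b ∈ v, i + 2 ≤ b) :
    u ++ i :: v ∈ F.sylvester ↔ u ++ v ∈ List.map (succAbove i) '' (F.trim i).sylvester := by
  have ancestor_i {b : ℕ} : F.Ancestor i b ↔ b = i := mem_qdes_iff.1 hi b
  have hiv : i ∉ v := fun h => by have := hv i h; omega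
  rw [mem_image_sylvester_trim_iff hi, mem_sylvester_iff, List.pairwise_append,
    List.pairwise_append, List.pairwise_cons]
  constructor
  · rintro ⟨hmem, hu, ⟨-, hv'⟩, huv⟩
    refine ⟨fun a => ?_, hu, hv', fun a ha b hb => huv a ha b (List.mem_cons_of_mem i hb)⟩
    have hiu : i ∉ u := fun h => huv i h i List.mem_cons_self (ancestor_i.2 rfl)
    grind
  · rintro ⟨hmem, hu, hv', huv⟩
    have hilab := mem_labels_of_mem_qdes hi
    refine ⟨by grind, hu, ⟨fun b hb hbi => ?_, hv'⟩, fun a ha b hb => ?_⟩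
    · have hbi' : F.Ancestor b (i + 1) :=
        hbi.of_mem_uIcc (Set.mem_uIcc.2 (by have := hv b hb; omega))
      have hiu : i + 1 ∈ u := by
        have := (hmem (i + 1)).2 ⟨hbi'.right_mem, by omega⟩
        grind
      exact huv _ hiu b hb hbi'
    · rcases List.mem_cons.1 hb with rfl | hb
      · exact fun h => ((hmem a).1 (by simp [ha])).2 (ancestor_i.1 h)
      · exact huv a ha b hb

end IndexedForest

/-! ### Subword sums -/

section WordSum

variable {α β R S : Type*}

section Semiring

variable [Semiring R] [Semiring S]

open Classical in
/-- The generating function `subwordSum` for a word whose letters are recorded together with their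
weights, with the sum over subwords unfolded along the word. -/
noncomputable def wordSum : List (α × R) → Set (List α) → R
  | [], D => if [] ∈ D then 1 else 0
  | p :: L, D => wordSum L D + p.2 * wordSum L (List.cons p.1 ⁻¹' D)

theorem subwordSum_eq_wordSum {ι : Type} (value : ι → ℕ) (weight : ι → Pol) (ω : List ι)
    (D : Set (List ℕ)) :
    subwordSum value weight ω D = wordSum (ω.map fun a => (value a, weight a)) D := by
  classical
  trans ((ω.sublists'.filter fun π => π.map value ∈ D).map fun π => (π.map weight).prod).sum
  · exact (((List.sublists_perm_sublists' ω).filter _).map _).sum_eq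
  induction ω generalizing D with
  | nil => by_cases h : [] ∈ D <;> simp [wordSum, h]
  | cons a ω ih =>
    rw [List.sublists'_cons, List.filter_append, List.map_append, List.sum_append, ih,
      List.map_cons, wordSum, ← ih (List.cons _ ⁻¹' D), List.filter_map, List.map_map,
      ← List.sum_map_mul_left]
    simp only [Function.comp_def, List.map_cons, List.prod_cons, Set.mem_preimage]

theorem wordSum_empty (L : List (α × R)) : wordSum L ∅ = 0 := by
  induction L with
  | nil => exact if_neg (Set.notMem_empty _)
  | cons p L ih => rw [wordSum, Set.preimage_empty, ih, mul_zero, add_zero]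

theorem wordSum_congr {L : List (α × R)} {D D' : Set (List α)}
    (h : ∀ w, w ⊆ L.map Prod.fst → (w ∈ D ↔ w ∈ D')) : wordSum L D = wordSum L D' := by
  classical
  induction L generalizing D D' with
  | nil => exact if_congr (h [] (List.nil_subset _)) rfl rfl
  | cons p L ih =>
    have hcons : wordSum L (List.cons p.1 ⁻¹' D) = wordSum L (List.cons p.1 ⁻¹' D') :=
      ih fun w hw => h (p.1 :: w) (List.cons_subset_cons p.1 hw)
    rw [wordSum, wordSum, hcons, ih fun w hw => h w (List.subset_cons_of_subset _ hw)]

theorem wordSum_map (φ : R →+* S) (g : α → β) (L : List (α × R)) (D : Set (List β)) :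
    wordSum (L.map (Prod.map g φ)) D = φ (wordSum L (List.map g ⁻¹' D)) := by
  induction L generalizing D with
  | nil => by_cases h : [] ∈ D <;> simp [wordSum, h]
  | cons p L ih =>
    rw [List.map_cons, wordSum, wordSum, ih, ih, map_add, map_mul]
    rfl

theorem wordSum_filter (P : α → Prop) [DecidablePred P] (L : List (α × R)) {D : Set (List α)}
    (h : ∀ w ∈ D, ∀ a ∈ w, P a) : wordSum (L.filter fun p => P p.1) D = wordSum L D := by
  induction L generalizing D with
  | nil => rfl
  | cons p L ih =>
    by_cases hp : P p.1
    · rw [List.filter_cons_of_pos (by simpa using hp), wordSum, wordSum, ih h,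
        ih (D := List.cons p.1 ⁻¹' D)
          fun w hw a ha => h (p.1 :: w) hw a (List.mem_cons_of_mem _ ha)]
    · have : List.cons p.1 ⁻¹' D = ∅ :=
        Set.eq_empty_of_forall_notMem fun w hw => hp (h _ hw _ List.mem_cons_self)
      rw [List.filter_cons_of_neg (by simpa using hp), wordSum, this, wordSum_empty, mul_zero,
        add_zero, ih h]

theorem wordSum_concat (L : List (α × R)) (p : α × R) (D : Set (List α)) :
    wordSum (L ++ [p]) D = wordSum L D + wordSum L ((· ++ [p.1]) ⁻¹' D) * p.2 := by
  induction L generalizing D with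
  | nil => by_cases h : [p.1] ∈ D <;> simp [wordSum, h]
  | cons q L ih =>
    rw [List.cons_append, wordSum, wordSum, wordSum, ih, ih, add_mul, mul_add, mul_assoc]
    exact add_add_add_comm _ _ _ _

end Semiring

theorem wordSum_append_cons [CommSemiring R] {L₁ L₂ : List (α × R)} {p : α × R}
    {D D' : Set (List α)}
    (h : ∀ u v, v ⊆ L₂.map Prod.fst → (u ++ p.1 :: v ∈ D ↔ u ++ v ∈ D')) :
    wordSum (L₁ ++ p :: L₂) D = wordSum (L₁ ++ L₂) D + p.2 * wordSum (L₁ ++ L₂) D' := by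
  induction L₁ generalizing D D' with
  | nil =>
    rw [List.nil_append, List.nil_append, wordSum,
      wordSum_congr (D := List.cons p.1 ⁻¹' D) (D' := D') (h [])]
  | cons q L₁ ih =>
    simp only [List.cons_append, wordSum]
    rw [ih h, ih (D' := List.cons q.1 ⁻¹' D') fun u v hv => h (q.1 :: u) v hv]
    ring

theorem isHomogeneous_wordSum {σ : Type*} [CommSemiring R] {L : List (α × MvPolynomial σ R)}
    {D : Set (List α)} {d : ℕ} (hL : ∀ p ∈ L, p.2.IsHomogeneous 1) (hD : ∀ w ∈ D, w.length = d) :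
    (wordSum L D).IsHomogeneous d := by
  induction L generalizing D d with
  | nil =>
    rw [wordSum]
    split_ifs with h
    · rw [← hD _ h]
      exact MvPolynomial.isHomogeneous_one _ _
    · exact MvPolynomial.isHomogeneous_zero _ _ _
  | cons p L ih =>
    have hp := hL p List.mem_cons_self
    have hL' : ∀ q ∈ L, q.2.IsHomogeneous 1 := fun q hq => hL q (List.mem_cons_of_mem _ hq)
    refine (ih hL' hD).add ?_
    cases d with
    | zero =>
      have : List.cons p.1 ⁻¹' D = ∅ :=
        Set.eq_empty_of_forall_notMem fun w hw => by simpa using hD _ hw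
      rw [this, wordSum_empty, mul_zero]
      exact MvPolynomial.isHomogeneous_zero _ _ _
    | succ d =>
      rw [add_comm d 1]
      exact hp.mul (ih hL' fun w hw => by simpa using hD _ hw)

/-- Two weighted words are equivalent if their subwords spelling the words of any set of words
without repeated letters have the same generating function. -/
def NodupEquiv [Semiring R] (L L' : List (α × R)) : Prop :=
  ∀ D : Set (List α), (∀ w ∈ D, w.Nodup) → wordSum L D = wordSum L' D

infix:50 " ≋ " => NodupEquiv

namespace NodupEquiv

section Semiring

variable [Semiring R] {L L' L'' K K' : List (α × R)}

@[refl]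
theorem refl (L : List (α × R)) : L ≋ L := fun _ _ => rfl

theorem trans (h : L ≋ L') (h' : L' ≋ L'') : L ≋ L'' :=
  fun D hD => (h D hD).trans (h' D hD)

instance : Trans (NodupEquiv (α := α) (R := R)) NodupEquiv NodupEquiv := ⟨trans⟩

theorem append_left (K : List (α × R)) (h : L ≋ L') : K ++ L ≋ K ++ L' := by
  induction K with
  | nil => exact h
  | cons p K ih =>
    intro D hD
    rw [List.cons_append, List.cons_append, wordSum, wordSum, ih D hD,
      ih (List.cons p.1 ⁻¹' D) fun w hw => (hD (p.1 :: w) hw).of_cons]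

theorem append_right (h : L ≋ L') (K : List (α × R)) : L ++ K ≋ L' ++ K := by
  induction K using List.reverseRecOn with
  | nil => rwa [List.append_nil, List.append_nil]
  | append_singleton K p ih =>
    intro D hD
    rw [← List.append_assoc, ← List.append_assoc, wordSum_concat, wordSum_concat, ih D hD,
      ih ((· ++ [p.1]) ⁻¹' D) fun w hw => (hD (w ++ [p.1]) hw).of_append_left]

theorem append (h : L ≋ L') (h' : K ≋ K') : L ++ K ≋ L' ++ K' :=
  (h.append_right K).trans (h'.append_left L')

theorem zero_weight (a : α) : [(a, (0 : R))] ≋ [] := by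
  intro D _
  simp only [wordSum, zero_mul, add_zero]

end Semiring

variable [Ring R]

theorem pair_neg (a : α) (r : R) : [(a, r), (a, -r)] ≋ [] := by
  intro D hD
  have : [a, a] ∉ D := fun h => by simpa using hD _ h
  by_cases h : [a] ∈ D <;> simp [wordSum, this, h]

theorem reverse_append_map_neg (l : List (α × R)) :
    l.reverse ++ l.map (Prod.map id Neg.neg) ≋ [] := by
  induction l with
  | nil => rfl
  | cons p l ih =>
    calc (p :: l).reverse ++ (p :: l).map (Prod.map id Neg.neg)
        = l.reverse ++ ([(p.1, p.2), (p.1, -p.2)] ++ l.map (Prod.map id Neg.neg)) := by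
          simp [Prod.map]
      _ ≋ l.reverse ++ ([] ++ l.map (Prod.map id Neg.neg)) :=
        ((pair_neg p.1 p.2).append_right _).append_left _
      _ ≋ [] := ih

end NodupEquiv

end WordSum

theorem NodupEquiv.flatMap_filter {α ι R : Type*} [Semiring R] {f : ι → List (α × R)}
    (P : ι → Prop) [DecidablePred P] (h : ∀ k, ¬ P k → f k ≋ []) (l : List ι) :
    l.flatMap f ≋ (l.filter P).flatMap f := by
  induction l with
  | nil => rfl
  | cons k l ih =>
    rw [List.flatMap_cons]
    by_cases hk : P k
    · rw [List.filter_cons_of_pos (by simpa using hk), List.flatMap_cons]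
      exact ih.append_left _
    · rw [List.filter_cons_of_neg (by simpa using hk)]
      exact (h k hk).append ih

/-! ### The long word -/

theorem filter_Ico_ne_eq_map_succAbove {i k k' m : ℕ} (hi : i ≤ m)
    (hk : ∀ j, k' ≤ succAbove i j ↔ k ≤ j) :
    (List.Ico k' (m + 1)).filter (· ≠ i) = (List.Ico k m).map (succAbove i) := by
  refine List.Pairwise.eq_of_mem_iff (r := (· < ·))
    ((List.Ico.pairwise_lt _ _).filter _)
    ((List.Ico.pairwise_lt _ _).map _ fun _ _ h => succAbove_strictMono i h) fun b => ?_
  by_cases hb : b = i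
  · have := succAbove_ne i
    simp [hb, this]
  · obtain ⟨j, rfl⟩ : b ∈ Set.range (succAbove i) := by rwa [range_succAbove]
    have hm : succAbove i j < m + 1 ↔ j < m := by grind [succAbove]
    rw [List.mem_map_of_injective (succAbove_strictMono i).injective]
    simp [succAbove_ne, hk, hm]

theorem flatMap_Ico_split {α : Type*} {f : ℕ → List α} {k i n : ℕ} (hn : f n = []) (hk : k ≤ i)
    (hi : i ≤ n) :
    (List.Ico k n).flatMap f =
      (List.Ico k i).flatMap f ++ (f i ++ (List.Ico (i + 1) n).flatMap f) := by
  rw [← List.Ico.append_consecutive hk hi, List.flatMap_append]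
  rcases hi.lt_or_eq with hi | rfl
  · rw [List.Ico.eq_cons hi, List.flatMap_cons]
  · rw [hn, List.Ico.eq_nil_of_le le_rfl, List.Ico.eq_nil_of_le (Nat.le_succ _)]
    rfl

/-- The sequence `y` with `a` inserted as its `i`-th entry. -/
def insertAt {α : Type*} (i : ℕ) (a : α) (y : ℕ → α) (j : ℕ) : α :=
  if j < i then y j else if j = i then a else y (j - 1)

section LongWord

variable {R : Type*} [CommRing R]

/-- The unbarred letters `j ∈ l` of a syllable, in reverse order and with weights `y - τ j`. -/
def descending (τ : ℕ → R) (l : List ℕ) (y : R) : List (ℕ × R) :=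
  l.reverse.map fun j => (j, y - τ j)

/-- The barred letters `j ∈ l` of a syllable, with weights `τ j - z`. -/
def ascending (τ : ℕ → R) (l : List ℕ) (z : R) : List (ℕ × R) :=
  l.map fun j => (j, τ j - z)

/-- The syllable `syllable n k` with the weights obtained by the substitution of `y` for `x k` and
of `τ` for `t`. -/
def weightedSyllable (τ : ℕ → R) (n k : ℕ) (y : R) : List (ℕ × R) :=
  descending τ (List.Ico k n) y ++ ascending τ (List.Ico (k + 1) n) (τ k)

/-- The long word `longWord n` with the weights obtained by the substitution of `y` for `x` and of
`τ` for `t`. -/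
def weightedWord (τ y : ℕ → R) (n : ℕ) : List (ℕ × R) :=
  (List.Ico 0 n).flatMap fun k => weightedSyllable τ n k (y k)

/-- The word left by the `i`-th trimming operation on `weightedWord τ y (m + 1)`. -/
def trimmedWord (τ y : ℕ → R) (m i : ℕ) : List (ℕ × R) :=
  (List.Ico 0 m).flatMap fun k => weightedSyllable τ (m + 1) (succAbove i k) (y k)

/-- The part of `trimmedWord τ y m i` before the position of the letter extracted by the `i`-th
trimming operation. -/
def trimmedHead (τ y : ℕ → R) (m i : ℕ) : List (ℕ × R) :=
  ((List.Ico 0 i).flatMap fun k => weightedSyllable τ (m + 1) k (y k)) ++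
    descending τ (List.Ico (i + 1) (m + 1)) (y i)

/-- The part of `trimmedWord τ y m i` after the position of the letter extracted by the `i`-th
trimming operation. -/
def trimmedTail (τ y : ℕ → R) (m i : ℕ) : List (ℕ × R) :=
  ascending τ (List.Ico (i + 2) (m + 1)) (τ (i + 1)) ++
    (List.Ico (i + 1) m).flatMap fun k => weightedSyllable τ (m + 1) (k + 1) (y k)

variable {τ y : ℕ → R} {i k m n : ℕ}

theorem subwordSum_longWord (n : ℕ) (D : Set (List ℕ)) :
    subwordSum Letter.value letterWeight (longWord n) D = wordSum (weightedWord t x n) D := by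
  rw [subwordSum_eq_wordSum, longWord, weightedWord, List.map_flatMap, List.Ico.zero_bot]
  simp [syllable, weightedSyllable, descending, ascending, letterWeight, Function.comp_def]

theorem descending_append_ascending_nodupEquiv (τ : ℕ → R) (l : List ℕ) (y : R) :
    descending τ l y ++ ascending τ l y ≋ [] := by
  have := NodupEquiv.reverse_append_map_neg (l.map fun j => (j, y - τ j))
  simpa [descending, ascending, Function.comp_def] using this

theorem ascending_append_descending_nodupEquiv (τ : ℕ → R) (l : List ℕ) (y : R) :
    ascending τ l y ++ descending τ l y ≋ [] := by
  have := NodupEquiv.reverse_append_map_neg (l.reverse.map fun j => (j, τ j - y))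
  simpa [descending, ascending, Function.comp_def] using this

theorem weightedSyllable_of_le (h : n ≤ k) (a : R) : weightedSyllable τ n k a = [] := by
  rw [weightedSyllable, List.Ico.eq_nil_of_le h, List.Ico.eq_nil_of_le (h.trans k.le_succ)]
  rfl

theorem descending_Ico (h : k < n) (a : R) :
    descending τ (List.Ico k n) a = descending τ (List.Ico (k + 1) n) a ++ [(k, a - τ k)] := by
  simp [descending, List.Ico.eq_cons h]

theorem weightedSyllable_self_nodupEquiv (τ : ℕ → R) (n k : ℕ) :
    weightedSyllable τ n k (τ k) ≋ [] := by
  rcases le_or_gt n k with h | h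
  · rw [weightedSyllable_of_le h]
  · rw [weightedSyllable, descending_Ico h, sub_self]
    calc descending τ (List.Ico (k + 1) n) (τ k) ++ [(k, 0)] ++
          ascending τ (List.Ico (k + 1) n) (τ k)
        ≋ descending τ (List.Ico (k + 1) n) (τ k) ++ [] ++
          ascending τ (List.Ico (k + 1) n) (τ k) :=
        ((NodupEquiv.zero_weight k).append_left _).append_right _
      _ ≋ [] := by
        rw [List.append_nil]
        exact descending_append_ascending_nodupEquiv _ _ _

theorem weightedWord_self_nodupEquiv (τ : ℕ → R) (n : ℕ) : weightedWord τ τ n ≋ [] := by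
  have := NodupEquiv.flatMap_filter (fun _ => False)
    (fun k _ => weightedSyllable_self_nodupEquiv τ n k) (List.Ico 0 n)
  simpa [weightedWord] using this

theorem weightedWord_congr {y' : ℕ → R} (h : ∀ k < n, y k = y' k) :
    weightedWord τ y n = weightedWord τ y' n := by
  refine List.flatMap_congr fun k hk => ?_
  rw [h k (List.Ico.mem.1 hk).2]

theorem weightedWord_insertAt_nodupEquiv (τ y : ℕ → R) (hi : i ≤ m) :
    weightedWord τ (insertAt i (τ i) y) (m + 1) ≋ trimmedWord τ y m i := by
  have hself (k : ℕ) (hk : ¬ k ≠ i) :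
      weightedSyllable τ (m + 1) k (insertAt i (τ i) y k) ≋ [] := by
    obtain rfl := not_not.1 hk
    simpa [insertAt] using weightedSyllable_self_nodupEquiv τ (m + 1) k
  have hsuccAbove (k : ℕ) : insertAt i (τ i) y (succAbove i k) = y k := by
    grind [insertAt, succAbove]
  have := NodupEquiv.flatMap_filter (· ≠ i) hself (List.Ico 0 (m + 1))
  rw [filter_Ico_ne_eq_map_succAbove (k := 0) hi (by simp), List.flatMap_map] at this
  simpa only [weightedWord, trimmedWord, hsuccAbove] using this

theorem trimmedWord_eq (τ y : ℕ → R) (hi : i ≤ m) :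
    trimmedWord τ y m i = trimmedHead τ y m i ++ trimmedTail τ y m i := by
  have hm : weightedSyllable τ (m + 1) (succAbove i m) (y m) = [] :=
    weightedSyllable_of_le (by grind [succAbove]) _
  rw [trimmedWord, flatMap_Ico_split hm (Nat.zero_le i) hi, trimmedHead, trimmedTail,
    weightedSyllable, succAbove, if_neg (lt_irrefl i)]
  have hlow : (List.Ico 0 i).flatMap (fun k => weightedSyllable τ (m + 1) (succAbove i k) (y k)) =
      (List.Ico 0 i).flatMap fun k => weightedSyllable τ (m + 1) k (y k) :=
    List.flatMap_congr fun k hk => by rw [succAbove, if_pos (List.Ico.mem.1 hk).2]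
  have hhigh :
      (List.Ico (i + 1) m).flatMap (fun k => weightedSyllable τ (m + 1) (succAbove i k) (y k)) =
      (List.Ico (i + 1) m).flatMap fun k => weightedSyllable τ (m + 1) (k + 1) (y k) :=
    List.flatMap_congr fun k hk => by
      rw [succAbove, if_neg (by have := (List.Ico.mem.1 hk).1; omega)]
  rw [hlow, hhigh]
  simp only [List.append_assoc]

theorem weightedWord_insertAt_succ_nodupEquiv (τ y : ℕ → R) (hi : i ≤ m) :
    weightedWord τ (insertAt (i + 1) (τ i) y) (m + 1) ≋
      trimmedHead τ y m i ++ (i, y i - τ i) :: trimmedTail τ y m i := by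
  set z := insertAt (i + 1) (τ i) y with hz
  have hsplit {k j : ℕ} := flatMap_Ico_split (f := fun k => weightedSyllable τ (m + 1) k (z k))
    (k := k) (i := j) (weightedSyllable_of_le le_rfl (z (m + 1)))
  have hlow : (List.Ico 0 i).flatMap (fun k => weightedSyllable τ (m + 1) k (z k)) =
      (List.Ico 0 i).flatMap fun k => weightedSyllable τ (m + 1) k (y k) :=
    List.flatMap_congr fun k hk => by
      rw [hz, insertAt, if_pos (by have := (List.Ico.mem.1 hk).2; omega)]
  have hhigh : (List.Ico (i + 2) (m + 1)).flatMap (fun k => weightedSyllable τ (m + 1) k (z k)) =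
      (List.Ico (i + 1) m).flatMap fun k => weightedSyllable τ (m + 1) (k + 1) (y k) := by
    rw [show List.Ico (i + 2) (m + 1) = (List.Ico (i + 1) m).map (1 + ·) from
      (List.Ico.map_add (i + 1) m 1).symm, List.flatMap_map]
    refine List.flatMap_congr fun k hk => ?_
    have hk : i + 1 ≤ k := (List.Ico.mem.1 hk).1
    rw [add_comm 1 k, hz, insertAt, if_neg (by omega), if_neg (by omega), Nat.add_sub_cancel]
  have hi' : z i = y i := by simp [hz, insertAt]
  have hi'' : z (i + 1) = τ i := by simp [hz, insertAt]
  have hcancel := ascending_append_descending_nodupEquiv τ (List.Ico (i + 1) (m + 1)) (τ i)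
  calc weightedWord τ z (m + 1)
      = (trimmedHead τ y m i ++ [(i, y i - τ i)]) ++
          ((ascending τ (List.Ico (i + 1) (m + 1)) (τ i) ++
            descending τ (List.Ico (i + 1) (m + 1)) (τ i)) ++ trimmedTail τ y m i) := by
        rw [weightedWord, hsplit (Nat.zero_le i) (by omega),
          hsplit le_rfl (by omega), List.Ico.self_empty, List.flatMap_nil,
          List.nil_append, hlow, hhigh, hi', hi'', weightedSyllable, weightedSyllable,
          descending_Ico (by omega), trimmedHead, trimmedTail]
        simp only [List.append_assoc]
    _ ≋ (trimmedHead τ y m i ++ [(i, y i - τ i)]) ++ ([] ++ trimmedTail τ y m i) :=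
      (hcancel.append_right _).append_left _
    _ = trimmedHead τ y m i ++ (i, y i - τ i) :: trimmedTail τ y m i := by simp

theorem add_two_le_of_mem_trimmedTail {p : ℕ × R} (hp : p ∈ trimmedTail τ y m i) :
    i + 2 ≤ p.1 := by
  simp only [trimmedTail, weightedSyllable, ascending, descending, List.mem_append, List.mem_map,
    List.mem_flatMap, List.mem_reverse, List.Ico.mem] at hp
  grind

theorem filter_weightedSyllable (τ : ℕ → R) (a : R) (hi : i ≤ m) (k : ℕ) :
    (weightedSyllable τ (m + 1) (succAbove i k) a).filter (fun p => p.1 ≠ i) =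
      (weightedSyllable (τ ∘ succAbove i) m k a).map (Prod.map (succAbove i) id) := by
  have hmono := succAbove_strictMono i
  have hdesc := filter_Ico_ne_eq_map_succAbove (k := k) hi fun j => hmono.le_iff_le
  have hasc := filter_Ico_ne_eq_map_succAbove (k := k + 1) hi fun j => hmono.lt_iff_lt
  simp only [weightedSyllable, descending, ascending, List.filter_append, List.filter_map,
    List.filter_reverse, Function.comp_def, hdesc, hasc, List.map_append, List.map_map,
    List.map_reverse, Prod.map, id]

theorem filter_trimmedWord (τ y : ℕ → R) (hi : i ≤ m) :
    (trimmedWord τ y m i).filter (fun p => p.1 ≠ i) =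
      (weightedWord (τ ∘ succAbove i) y m).map (Prod.map (succAbove i) id) := by
  rw [trimmedWord, weightedWord, List.filter_flatMap, List.map_flatMap]
  exact List.flatMap_congr fun k _ => filter_weightedSyllable τ (y k) hi k

theorem filter_weightedWord_lt (τ y : ℕ → R) (h : n ≤ m) :
    (weightedWord τ y m).filter (fun p => p.1 < n) = weightedWord τ y n := by
  have hsyllable (k : ℕ) (a : R) :
      (weightedSyllable τ m k a).filter (fun p => p.1 < n) = weightedSyllable τ n k a := by
    simp [weightedSyllable, descending, ascending, List.filter_append, List.filter_map,
      List.filter_reverse, Function.comp_def, h]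
  rw [weightedWord, List.filter_flatMap]
  simp only [hsyllable]
  rw [← List.Ico.append_consecutive (Nat.zero_le n) h, List.flatMap_append, ← weightedWord]
  refine List.append_right_eq_self.2 (List.flatMap_eq_nil_iff.2 fun k hk => ?_)
  exact weightedSyllable_of_le (List.Ico.mem.1 hk).1 _

end LongWord

/-! ### Trimming operations -/

theorem x_sub_t_ne_zero (i : ℕ) : x i - t i ≠ 0 :=
  sub_ne_zero.2 fun h => Sum.inl_ne_inr (MvPolynomial.X_injective h)

theorem eope_eq_of_mul_eq {i : ℕ} {f g : Pol}
    (h : (x i - t i) * g = ropePlus i f - ropeMinus i f) : eope i f = g :=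
  mul_left_cancel₀ (x_sub_t_ne_zero i) ((mul_eope i f).trans h.symm)

theorem eope_sub (i : ℕ) (f g : Pol) : eope i (f - g) = eope i f - eope i g := by
  apply eope_eq_of_mul_eq
  rw [mul_sub, mul_eope, mul_eope, map_sub, map_sub]
  ring

theorem subst_x (a b : ℕ → Pol) (i : ℕ) : subst a b (x i) = a i := by
  simp [subst, x]

theorem subst_t (a b : ℕ → Pol) (i : ℕ) : subst a b (t i) = b i := by
  simp [subst, t]

theorem subst_comp_subst (a b c d : ℕ → Pol) :
    (subst a b).comp (subst c d) = subst (subst a b ∘ c) (subst a b ∘ d) := by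
  refine MvPolynomial.algHom_ext fun s => ?_
  cases s <;> simp [subst]

theorem subst_x_t (f : Pol) : subst x t f = f := by
  have : Sum.elim x t = MvPolynomial.X := by
    funext s
    cases s <;> rfl
  rw [subst, this, MvPolynomial.aeval_X_left_apply]

theorem ropeMinus_eq_subst (i : ℕ) : ropeMinus i = subst (insertAt i (t i) x) t := rfl

theorem ropePlus_eq_subst (i : ℕ) : ropePlus i = subst (insertAt (i + 1) (t i) x) t := by
  rw [ropePlus]
  congr 1
  funext j
  simp only [insertAt, Nat.lt_succ_iff]

/-- The sequence `x_0, …, x_{k-1}, t_k, t_{k+1}, …`, which interpolates between `t` and `x`. -/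
noncomputable def mixed (k j : ℕ) : Pol := if j < k then x j else t j

theorem ropePlus_subst_mixed (k : ℕ) (f : Pol) :
    ropePlus k (subst (mixed (k + 1)) t f) = subst (mixed (k + 1)) t f := by
  have ht : ropePlus k ∘ t = t := funext fun j => subst_t _ _ j
  have hmixed : ropePlus k ∘ mixed (k + 1) = mixed (k + 1) := by
    funext j
    rw [Function.comp_apply, mixed]
    split_ifs with h
    · rw [ropePlus_eq_subst, subst_x, insertAt, if_pos h]
    · exact congrFun ht j
  rw [← AlgHom.comp_apply, ropePlus, subst_comp_subst, ← ropePlus, ht, hmixed]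

theorem ropeMinus_subst_mixed (k : ℕ) (f : Pol) :
    ropeMinus k (subst (mixed (k + 1)) t f) = subst (mixed k) t f := by
  have ht : ropeMinus k ∘ t = t := funext fun j => subst_t _ _ j
  have hmixed : ropeMinus k ∘ mixed (k + 1) = mixed k := by
    funext j
    rw [Function.comp_apply, mixed, mixed]
    rcases lt_trichotomy j k with h | rfl | h
    · rw [if_pos (by omega), ropeMinus, subst_x, if_pos h, if_pos h]
    · rw [if_pos (Nat.lt_succ_self j), ropeMinus, subst_x]
      simp only [lt_irrefl, if_true, if_false]
    · rw [if_neg (by omega), if_neg (by omega)]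
      exact congrFun ht j
  rw [← AlgHom.comp_apply, ropeMinus, subst_comp_subst, ← ropeMinus, ht, hmixed]

theorem exists_subst_mixed_eq_self (f : Pol) : ∃ k, subst (mixed k) t f = f := by
  obtain ⟨k, hk⟩ := (f.vars.finite_toSet.preimage Sum.inl_injective.injOn).bddAbove
  refine ⟨k + 1, ?_⟩
  conv_rhs => rw [← subst_x_t f]
  refine MvPolynomial.eval₂Hom_congr' rfl (fun s hs _ => ?_) rfl
  cases s with
  | inl j => exact if_pos (Nat.lt_succ_of_le (hk hs))
  | inr j => rfl

theorem subst_t_t_eq_self {f : Pol} (h : ∀ i, eope i f = 0) : subst t t f = f := by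
  have hrope (k : ℕ) : ropePlus k f = ropeMinus k f := by
    rw [← sub_eq_zero, ← mul_eope, h, mul_zero]
  have hmixed (k : ℕ) (hk : subst (mixed k) t f = f) : subst (mixed 0) t f = f := by
    induction k with
    | zero => exact hk
    | succ k ih =>
      apply ih
      calc subst (mixed k) t f = ropeMinus k f := by rw [← ropeMinus_subst_mixed, hk]
        _ = ropePlus k f := (hrope k).symm
        _ = f := by rw [← hk, ropePlus_subst_mixed]
  obtain ⟨k, hk⟩ := exists_subst_mixed_eq_self f
  exact hmixed k hk

theorem eq_of_eope_eq {f g : Pol} (h : ∀ i, eope i f = eope i g)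
    (h₀ : subst t t f = subst t t g) : f = g := by
  have heope (i : ℕ) : eope i (f - g) = 0 := by rw [eope_sub, h, sub_self]
  rw [← sub_eq_zero, ← subst_t_t_eq_self heope, map_sub, h₀, sub_self]

theorem subst_wordSum_weightedWord (a b : ℕ → Pol) (n : ℕ) (D : Set (List ℕ)) :
    subst a b (wordSum (weightedWord t x n) D) = wordSum (weightedWord b a n) D := by
  have h := wordSum_map (subst a b : Pol →+* Pol) id (weightedWord t x n) D
  have hmap : (weightedWord t x n).map (Prod.map id (subst a b : Pol →+* Pol)) =
      weightedWord b a n := by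
    simp [weightedWord, weightedSyllable, descending, ascending, List.map_flatMap,
      Function.comp_def, subst_x, subst_t]
  rw [hmap, List.map_id_fun, Set.preimage_id] at h
  exact h.symm

theorem eope_wordSum_weightedWord {i m : ℕ} (hi : i ≤ m) {D D' : Set (List ℕ)}
    (hD : ∀ w ∈ D, w.Nodup)
    (h : ∀ u v, (∀ b ∈ v, i + 2 ≤ b) → (u ++ i :: v ∈ D ↔ u ++ v ∈ D')) :
    eope i (wordSum (weightedWord t x (m + 1)) D) = wordSum (trimmedWord t x m i) D' := by
  have htail (u v : List ℕ) (hv : v ⊆ (trimmedTail t x m i).map Prod.fst) :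
      u ++ i :: v ∈ D ↔ u ++ v ∈ D' := by
    refine h u v fun b hb => ?_
    obtain ⟨p, hp, rfl⟩ := List.mem_map.1 (hv hb)
    exact add_two_le_of_mem_trimmedTail hp
  have hplus : ropePlus i (wordSum (weightedWord t x (m + 1)) D) =
      wordSum (trimmedWord t x m i) D + (x i - t i) * wordSum (trimmedWord t x m i) D' := by
    rw [ropePlus_eq_subst, subst_wordSum_weightedWord,
      weightedWord_insertAt_succ_nodupEquiv t x hi D hD, wordSum_append_cons htail,
      trimmedWord_eq t x hi]
  have hminus : ropeMinus i (wordSum (weightedWord t x (m + 1)) D) =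
      wordSum (trimmedWord t x m i) D := by
    rw [ropeMinus_eq_subst, subst_wordSum_weightedWord,
      weightedWord_insertAt_nodupEquiv t x hi D hD]
  refine eope_eq_of_mul_eq ?_
  rw [hplus, hminus, add_sub_cancel_left]

theorem eope_wordSum_weightedWord_of_le {i n : ℕ} (h : n ≤ i) (D : Set (List ℕ)) :
    eope i (wordSum (weightedWord t x n) D) = 0 := by
  refine eope_eq_of_mul_eq ?_
  rw [mul_zero, ropePlus_eq_subst, ropeMinus_eq_subst, subst_wordSum_weightedWord,
    subst_wordSum_weightedWord, weightedWord_congr, sub_self]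
  intro k hk
  rw [insertAt, insertAt, if_pos (by omega), if_pos (by omega)]

theorem tHat_eq (i : ℕ) : tHat i = t ∘ succAbove i := by
  funext j
  exact (apply_ite t (j < i) j (j + 1)).symm

theorem wordSum_trimmedWord {i m : ℕ} (hi : i ≤ m) (D : Set (List ℕ)) :
    wordSum (trimmedWord t x m i) (List.map (succAbove i) '' D) =
      subst x (tHat i) (wordSum (weightedWord t x m) D) := by
  have hinj : (List.map (succAbove i)).Injective :=
    List.map_injective_iff.2 (succAbove_strictMono i).injective
  have hne : ∀ w ∈ List.map (succAbove i) '' D, ∀ a ∈ w, a ≠ i := by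
    rintro _ ⟨w, -, rfl⟩ a ha
    obtain ⟨b, -, rfl⟩ := List.mem_map.1 ha
    exact succAbove_ne i b
  have hmap := wordSum_map (RingHom.id Pol) (succAbove i) (weightedWord (tHat i) x m)
    (List.map (succAbove i) '' D)
  rw [← wordSum_filter (· ≠ i) _ hne, filter_trimmedWord t x hi, ← tHat_eq,
    subst_wordSum_weightedWord]
  rwa [Set.preimage_image_eq D hinj] at hmap

/-! ### Double forest polynomials -/

/-- The vine subword model of size `n`: the generating function of the Sylvester words of `F` in
the long word. -/
noncomputable def vineSum (n : ℕ) (F : IndexedForest) : Pol :=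
  wordSum (weightedWord t x n) F.sylvester

open Classical in
theorem subst_t_t_vineSum (n : ℕ) (F : IndexedForest) :
    subst t t (vineSum n F) = if F = IndexedForest.empty then 1 else 0 := by
  rw [vineSum, subst_wordSum_weightedWord,
    weightedWord_self_nodupEquiv t n F.sylvester fun _ hw => hw.1, wordSum]
  simp only [IndexedForest.nil_mem_sylvester_iff]

theorem eope_vineSum_of_mem_qdes {i m : ℕ} (him : i ≤ m) {F : IndexedForest} (hi : i ∈ F.qdes) :
    eope i (vineSum (m + 1) F) = subst x (tHat i) (vineSum m (F.trim i)) := by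
  rw [vineSum, vineSum, ← wordSum_trimmedWord him]
  exact eope_wordSum_weightedWord him (fun _ hw => hw.1) fun _ _ hv =>
    IndexedForest.append_cons_mem_sylvester_iff hi hv

theorem eope_vineSum_of_notMem_qdes (n : ℕ) {i : ℕ} {F : IndexedForest} (hi : i ∉ F.qdes) :
    eope i (vineSum n F) = 0 := by
  rcases le_or_gt n i with h | h
  · exact eope_wordSum_weightedWord_of_le h _
  · obtain ⟨m, rfl⟩ := Nat.exists_eq_add_one_of_ne_zero (Nat.ne_zero_of_lt h)
    rw [vineSum, eope_wordSum_weightedWord (D' := ∅) (by omega) fun _ hw => hw.1, wordSum_empty]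
    exact fun u v hv => iff_of_false
      (fun h => hi (IndexedForest.mem_qdes_of_append_cons_mem_sylvester h hv)) id

theorem isHomogeneous_of_mem_weightedWord {n : ℕ} {p : ℕ × Pol} (hp : p ∈ weightedWord t x n) :
    p.2.IsHomogeneous 1 := by
  simp only [weightedWord, weightedSyllable, descending, ascending, List.mem_flatMap,
    List.mem_append, List.mem_map] at hp
  obtain ⟨k, -, ⟨j, -, rfl⟩ | ⟨j, -, rfl⟩⟩ := hp <;>
    exact (MvPolynomial.isHomogeneous_X _ _).sub (MvPolynomial.isHomogeneous_X _ _)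

theorem exists_isHomogeneous_vineSum (n : ℕ) (F : IndexedForest) :
    ∃ d, (vineSum n F).IsHomogeneous d := by
  rcases F.sylvester.eq_empty_or_nonempty with h | ⟨w, hw⟩
  · refine ⟨0, ?_⟩
    rw [vineSum, h, wordSum_empty]
    exact MvPolynomial.isHomogeneous_zero _ _ _
  · exact ⟨w.length, isHomogeneous_wordSum (fun _ => isHomogeneous_of_mem_weightedWord)
      fun _ hw' => (IndexedForest.perm_of_mem_sylvester hw' hw).length_eq⟩

theorem vineSum_eq_of_le {n m : ℕ} (h : n ≤ m) {F : IndexedForest}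
    (hF : F.support ⊆ Set.Iio (n + 1)) : vineSum n F = vineSum m F := by
  have hlt : ∀ w ∈ F.sylvester, ∀ a ∈ w, a < n := fun w hw a ha =>
    IndexedForest.support_subset_iff.1 hF ((hw.2.1 a).1 ha)
  rw [vineSum, vineSum, ← filter_weightedWord_lt t x h, wordSum_filter (· < n) _ hlt]

/-- The double forest polynomial of `F`, by the vine subword model of any size large enough for
`F`. -/
noncomputable def doubleForest (F : IndexedForest) : Pol :=
  vineSum (Classical.choose F.exists_support_subset) F

theorem doubleForest_eq_vineSum {n : ℕ} {F : IndexedForest} (hF : F.support ⊆ Set.Iio (n + 1)) :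
    doubleForest F = vineSum n F := by
  have h := Classical.choose_spec F.exists_support_subset
  rcases le_total (Classical.choose F.exists_support_subset) n with hn | hn
  · exact vineSum_eq_of_le hn h
  · exact (vineSum_eq_of_le hn hF).symm

theorem isDoubleForestFamily_doubleForest : IsDoubleForestFamily doubleForest where
  homogeneous F := exists_isHomogeneous_vineSum _ F
  normalized F := subst_t_t_vineSum _ F
  recursion F i := by
    split_ifs with hi
    · obtain ⟨n, hn⟩ := F.exists_support_subset
      have hin := IndexedForest.lt_of_mem_qdes hn hi
      obtain ⟨m, rfl⟩ := Nat.exists_eq_add_one_of_ne_zero (Nat.ne_zero_of_lt hin)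
      rw [doubleForest_eq_vineSum hn,
        doubleForest_eq_vineSum (IndexedForest.support_trim_subset hn hi),
        eope_vineSum_of_mem_qdes (Nat.le_of_lt_succ hin) hi]
    · exact eope_vineSum_of_notMem_qdes _ hi

theorem IsDoubleForestFamily.eq {P Q : IndexedForest → Pol} (hP : IsDoubleForestFamily P)
    (hQ : IsDoubleForestFamily Q) : P = Q := by
  funext F
  obtain ⟨n, hF⟩ := F.exists_support_subset
  induction n generalizing F with
  | zero =>
    refine eq_of_eope_eq (fun i => ?_) (by rw [hP.normalized, hQ.normalized])
    have hi : i ∉ F.qdes := fun hi => Nat.not_lt_zero i (IndexedForest.lt_of_mem_qdes hF hi)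
    rw [hP.recursion, hQ.recursion, if_neg hi, if_neg hi]
  | succ n ih =>
    refine eq_of_eope_eq (fun i => ?_) (by rw [hP.normalized, hQ.normalized])
    rw [hP.recursion, hQ.recursion]
    split_ifs with hi
    · rw [ih _ (IndexedForest.support_trim_subset hF hi)]
    · rfl

end DoubleForest

open DoubleForest in
theorem theorem4p2 :
    (∃! P : IndexedForest → Pol, IsDoubleForestFamily P) ∧
      ∀ P : IndexedForest → Pol, IsDoubleForestFamily P →
        ∀ (n : ℕ) (F : IndexedForest), F.support ⊆ Set.Iio (n + 1) →
          P F = subwordSum Letter.value letterWeight (longWord n) F.sylvester := by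
  refine ⟨⟨doubleForest, isDoubleForestFamily_doubleForest,
    fun P hP => hP.eq isDoubleForestFamily_doubleForest⟩, ?_⟩
  intro P hP n F hF
  rw [hP.eq isDoubleForestFamily_doubleForest, doubleForest_eq_vineSum hF, vineSum,
    subwordSum_longWord]
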